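/- Let $R$ be a Dedekind domain (fields allowed) and let $\mathcal C$ be an $R$-linear abelian category. Let $\mathsf{Mod}_f(R)$ be the category of finitely generated $R$-modules and let $\omega:\mathcal C\to\mathsf{Mod}_f(R)$ be an $R$-linear exact faithful functor. Assume that there is a full subcategory $\mathcal C^{o}\subseteq\mathcal C$ such that $\omega(X)$ is a projective $R$-module for every $X\in\mathcal C^{o}$ and every object of $\mathcal C$ is a quotient of an object of $\mathcal C^{o}$ (a \emph{subcategory of definition} of $\mathcal C$ with respect to $\omega$). Let $F:\mathcal C^{op}\to\mathsf{Mod}(R)$ be the functor $F(X)=\mathrm{Hom}_R(\omega(X),R)$, and let $L=\omega(F)$ be the value at $F$ of the extension of $\omega$ to ind-objects, that is $$L=\varinjlim_{(X,\varphi)}\omega(X),$$ the colimit over the category of elements of $F$, whose objects are the pairs $(X,\varphi)$ with $X\in\mathcal C$ and $\varphi\in F(X)$ and whose morphisms $(X,\varphi)\to(Y,\psi)$ are the $f:X\to Y$ in $\mathcal C$ with $\psi\circ\omega(f)=\varphi$. Let $c_{X,\varphi}:\omega(X)\to L$ be the canonical maps. Then $L$ is a flat $R$-module, and it carries a structure of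 a (coassociative, counital) $R$-coalgebra, with counit $\varepsilon$ given by $\varepsilon\circ c_{X,\varphi}=\varphi$, such that $\omega$ factors, up to natural isomorphism, as an $R$-linear equivalence $$\mathcal C\simeq\mathsf{Comod}_f(L)$$ onto the category of right $L$-comodules that are finitely generated over $R$, followed by the forgetful functor $\mathsf{Comod}_f(L)\to\mathsf{Mod}_f(R)$. The resulting coactions $\rho_X:\omega(X)\to\omega(X)\otimes_R L$ satisfy $(\varphi\otimes\mathrm{id}_L)\circ\rho_X=c_{X,\varphi}$ for all $X\in\mathcal C$ and $\varphi\in\mathrm{Hom}_R(\omega(X),R)$. Moreover $L$ with $\rho$ is the coend of $\omega$: the $\rho_X$ are natural in $X$, and for every $R$-module $M$ the map $f\mapsto(\mathrm{id}\otimes f)\circ\rho$ is a bijection $$\mathrm{Hom}_R(L,M)\ \xrightarrow{\ \sim\ }\ \mathrm{Nat}(\omega,\omega\otimes_R M).$$ -/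

import Mathlib

open CategoryTheory CategoryTheory.Limits Opposite TensorProduct

universe u v w x

noncomputable section

/-! ### The category of finite right comodules over a coalgebra -/

/-- A finite right comodule over an `R`-coalgebra `L`: a finitely generated `R`-module `E` with a
coassociative and counital coaction `E → E ⊗ L`. -/
structure FinComodule (R : Type w) [CommRing R] (L : Type x) [AddCommGroup L] [Module R L]
    [Coalgebra R L] where
  /-- the underlying finitely generated module -/
  toMod : FGModuleCat.{w} R
  /-- the coaction -/
  coact : toMod →ₗ[R] toMod ⊗[R] L
  coassoc : (TensorProduct.assoc R toMod L L).toLinearMap ∘ₗ coact.rTensor L ∘ₗ coact =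
    (Coalgebra.comul (R := R) (A := L)).lTensor toMod ∘ₗ coact
  counit : (TensorProduct.rid R toMod).toLinearMap ∘ₗ
    (Coalgebra.counit (R := R) (A := L)).lTensor toMod ∘ₗ coact = LinearMap.id

namespace FinComodule

variable {R : Type w} [CommRing R] {L : Type x} [AddCommGroup L] [Module R L] [Coalgebra R L]

/-- Homomorphisms of right comodules, as a submodule of the module of linear maps: those `g` with
`ρ_E' ∘ g = (g ⊗ id) ∘ ρ_E`. -/
def homSubmodule (E E' : FinComodule R L) : Submodule R (E.toMod →ₗ[R] E'.toMod) where
  carrier := {g | E'.coact ∘ₗ g = g.rTensor L ∘ₗ E.coact}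
  add_mem' {g h} hg hh := by
    simp only [Set.mem_ofPred_eq] at *
    rw [LinearMap.comp_add, hg, hh, LinearMap.rTensor_add, LinearMap.add_comp]
  zero_mem' := by simp
  smul_mem' r g hg := by
    simp only [Set.mem_ofPred_eq] at *
    rw [LinearMap.comp_smul, hg, LinearMap.rTensor_smul, LinearMap.smul_comp]

lemma mem_homSubmodule {E E' : FinComodule R L} (g : E.toMod →ₗ[R] E'.toMod) :
    g ∈ homSubmodule E E' ↔ E'.coact ∘ₗ g = g.rTensor L ∘ₗ E.coact := Iff.rfl

instance : Category (FinComodule R L) where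
  Hom E E' := homSubmodule E E'
  id E := ⟨LinearMap.id, by simp [mem_homSubmodule]⟩
  comp {E E' E''} g h := ⟨h.1 ∘ₗ g.1, by
    have hg := (mem_homSubmodule g.1).1 g.2
    have hh := (mem_homSubmodule h.1).1 h.2
    rw [mem_homSubmodule, ← LinearMap.comp_assoc, hh, LinearMap.comp_assoc, hg,
      LinearMap.rTensor_comp, LinearMap.comp_assoc]⟩

/-- The linear map underlying a comodule homomorphism. -/
def homLinear {E E' : FinComodule R L} (g : E ⟶ E') : E.toMod →ₗ[R] E'.toMod :=
  Subtype.val (p := fun g => g ∈ homSubmodule E E') g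

instance (E E' : FinComodule R L) : AddCommGroup (E ⟶ E') :=
  inferInstanceAs (AddCommGroup (homSubmodule E E'))

instance (E E' : FinComodule R L) : Module R (E ⟶ E') :=
  inferInstanceAs (Module R (homSubmodule E E'))

instance : Preadditive (FinComodule R L) where
  add_comp _ _ _ g g' h := Subtype.ext (LinearMap.comp_add g.1 g'.1 h.1)
  comp_add _ _ _ g h h' := Subtype.ext (LinearMap.add_comp g.1 h'.1 h.1)

instance : Linear R (FinComodule R L) where
  smul_comp _ _ _ r g h := Subtype.ext (LinearMap.comp_smul h.1 r g.1)
  comp_smul _ _ _ g r h := Subtype.ext (LinearMap.smul_comp r h.1 g.1)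

variable (R L) in
/-- The forgetful functor from finite comodules to finitely generated modules. -/
def forget : FinComodule R L ⥤ FGModuleCat.{w} R where
  obj E := E.toMod
  map g := ⟨ModuleCat.ofHom (homLinear g)⟩

end FinComodule

/-! ### Subcategories of definition, the extension of `ω` to ind-objects, and the functor `F` -/

namespace Reconstruction

variable {R : Type w} [CommRing R] {C : Type u} [Category.{v} C] (ω : C ⥤ FGModuleCat.{w} R)

/-- The linear map underlying `ω(f) : ω(X) → ω(Y)`. -/
abbrev mapLin {X Y : C} (f : X ⟶ Y) : ω.obj X →ₗ[R] ω.obj Y := (ω.map f).hom.hom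

/-- A full subcategory `C₀` of `C` is a subcategory of definition with respect to `ω` if `ω` takes
its objects to (finitely generated) projective modules and every object of `C` is a quotient of an
object of `C₀`. -/
structure IsSubcategoryOfDefinition (C₀ : ObjectProperty C) : Prop where
  projective : ∀ X : C, C₀ X → Module.Projective R (ω.obj X)
  exists_epi : ∀ X : C, ∃ (P : C) (p : P ⟶ X), C₀ P ∧ Epi p

section IndExtension

variable (G : Cᵒᵖ ⥤ ModuleCat.{w} R)

/-- The index set of the canonical presentation `G = colim h_X` of a presheaf `G`: the objects of
its category of elements, that is pairs of an object `X` and an element of `G(X)`. -/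
abbrev Elt : Type (max u w) := Σ X : C, G.obj (op X)

open Classical in
/-- The relations of `colim ω(X)` over the category of elements of `G`: for `f : X ⟶ Y`,
`g ∈ G(Y)` and `v ∈ ω(X)`, the element `v` at `(X, G(f) g)` is identified with `ω(f) v` at
`(Y, g)`. -/
def relations : Submodule R (DirectSum (Elt G) fun p => ω.obj p.1) :=
  Submodule.span R {z | ∃ (X Y : C) (f : X ⟶ Y) (g : G.obj (op Y)) (v : ω.obj X),
    z = DirectSum.lof R (Elt G) (fun p => ω.obj p.1) ⟨X, G.map f.op g⟩ v -
      DirectSum.lof R (Elt G) (fun p => ω.obj p.1) ⟨Y, g⟩ (mapLin ω f v)}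

/-- The value at `G` of the extension of `ω` to ind-objects, where an ind-object is regarded as a
(left exact) functor `G : Cᵒᵖ ⥤ Mod(R)`: since `G = colim h_X` over its category of elements (which
is filtered if `G` is left exact), `ω(G) = colim ω(X)` over the same category. -/
def IndExt : Type (max u w) := (DirectSum (Elt G) fun p => ω.obj p.1) ⧸ relations ω G

instance : AddCommGroup (IndExt ω G) := inferInstanceAs (AddCommGroup (_ ⧸ relations ω G))

instance : Module R (IndExt ω G) := inferInstanceAs (Module R (_ ⧸ relations ω G))

namespace IndExt

open Classical in
/-- The canonical map `ω(X) → ω(G)` attached to an element of `G(X)`. -/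
def ι (X : C) (g : G.obj (op X)) : ω.obj X →ₗ[R] IndExt ω G :=
  (relations ω G).mkQ ∘ₗ DirectSum.lof R (Elt G) (fun p => ω.obj p.1) ⟨X, g⟩

lemma ι_comp_map {X Y : C} (f : X ⟶ Y) (g : G.obj (op Y)) :
    ι ω G Y g ∘ₗ mapLin ω f = ι ω G X (G.map f.op g) := by
  classical
  ext v
  refine ((Submodule.Quotient.eq (relations ω G)).2 ?_).symm
  refine Submodule.subset_span ⟨X, Y, f, g, v, ?_⟩
  congr!

variable {G} in
lemma hom_ext {M : Type*} [AddCommGroup M] [Module R M] {a b : IndExt ω G →ₗ[R] M}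
    (h : ∀ (X : C) (g : G.obj (op X)), a ∘ₗ ι ω G X g = b ∘ₗ ι ω G X g) : a = b := by
  classical
  refine Submodule.linearMap_qext _ (DirectSum.linearMap_ext R fun p => ?_)
  ext v
  exact LinearMap.congr_fun (h p.1 p.2) v

/-- Together with `hom_ext`: `ω(G)` has the universal property of the colimit of the modules `ω(X)`
over the category of elements of `G`. -/
lemma exists_desc {M : Type*} [AddCommGroup M] [Module R M]
    (t : ∀ X : C, G.obj (op X) → (ω.obj X →ₗ[R] M))
    (ht : ∀ (X Y : C) (f : X ⟶ Y) (g : G.obj (op Y)),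
      t Y g ∘ₗ mapLin ω f = t X (G.map f.op g)) :
    ∃ d : IndExt ω G →ₗ[R] M, ∀ (X : C) (g : G.obj (op X)), d ∘ₗ ι ω G X g = t X g := by
  classical
  refine ⟨(relations ω G).liftQ (DirectSum.toModule R (Elt G) M fun p => t p.1 p.2) ?_, ?_⟩
  · refine Submodule.span_le.2 ?_
    rintro z ⟨X, Y, f, g, v, rfl⟩
    have := LinearMap.congr_fun (ht X Y f g) v
    simp only [SetLike.mem_coe, LinearMap.mem_ker, map_sub, sub_eq_zero]
    erw [DirectSum.toModule_lof, DirectSum.toModule_lof]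
    exact this.symm
  · intro X g
    ext v
    exact DirectSum.toModule_lof (M := fun p : Elt G => ω.obj p.1) R
      (φ := fun p : Elt G => t p.1 p.2) (⟨X, g⟩ : Elt G) v

end IndExt

end IndExtension

/-- The functor `F : Cᵒᵖ ⥤ Mod(R)`, `F(X) = Hom_R(ω(X), R)`. -/
def dualFunctor : Cᵒᵖ ⥤ ModuleCat.{w} R where
  obj X := ModuleCat.of R (ω.obj X.unop →ₗ[R] R)
  map f := ModuleCat.ofHom (LinearMap.lcomp R R (mapLin ω f.unop))
  map_id X := by
    ext φ v
    exact congrArg φ (by simp [mapLin])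
  map_comp f g := by
    ext φ v
    exact congrArg φ (by simp [mapLin])

/-- The module `L = ω(F)`. -/
abbrev CoendModule : Type (max u w) := IndExt ω (dualFunctor ω)

/-- The canonical map `ω(X) → ω(F)` attached to a linear form `φ ∈ F(X)` on `ω(X)`. -/
def coefficient (X : C) (φ : ω.obj X →ₗ[R] R) : ω.obj X →ₗ[R] CoendModule ω :=
  IndExt.ι ω (dualFunctor ω) X φ

section

variable {ω} {L : Type x} [AddCommGroup L] [Module R L] [Coalgebra R L]

/-- The coaction `ω(X) → ω(X) ⊗ L` obtained from a factorization of `ω` through `Comod_f(L)`. -/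
def coaction {Φ : C ⥤ FinComodule R L} (α : Φ ⋙ FinComodule.forget R L ≅ ω) (X : C) :
    ω.obj X →ₗ[R] ω.obj X ⊗[R] L :=
  LinearMap.rTensor L (α.hom.app X).hom.hom ∘ₗ (Φ.obj X).coact ∘ₗ (α.inv.app X).hom.hom

/-- `L`, with maps `ρ_X : ω(X) → ω(X) ⊗ L`, is the coend of `ω`: for every `R`-module `M`, the map
`f ↦ (id ⊗ f) ∘ ρ` is a bijection from `Hom_R(L, M)` onto the natural transformations
`ω → ω ⊗ M`. -/
structure IsCoend (ω : C ⥤ FGModuleCat.{w} R) {L : Type x} [AddCommGroup L] [Module R L]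
    (ρ : ∀ X : C, ω.obj X →ₗ[R] ω.obj X ⊗[R] L) : Prop where
  natural : ∀ (X Y : C) (f : X ⟶ Y), ρ Y ∘ₗ mapLin ω f = (mapLin ω f).rTensor L ∘ₗ ρ X
  existsUnique : ∀ (M : Type (max u w x)) [AddCommGroup M] [Module R M]
    (t : ∀ X : C, ω.obj X →ₗ[R] ω.obj X ⊗[R] M),
    (∀ (X Y : C) (f : X ⟶ Y), t Y ∘ₗ mapLin ω f = (mapLin ω f).rTensor M ∘ₗ t X) →
    ∃! f : L →ₗ[R] M, ∀ X : C, t X = f.lTensor (ω.obj X) ∘ₗ ρ X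

end

end Reconstruction

end

/-! Every element of `L` is a single coefficient `c_{X,φ}(v)`, since biproducts absorb sums
(`exists_coefficient_eq`). It vanishes only if `v` lifts along some `k : K ⟶ X` with `φ ∘ ω(k) = 0`
(`exists_lift_of_coefficient_eq_zero`). This criterion makes `L` torsion-free, hence flat over a
Dedekind domain.

If `ω(P)` is projective, a dual basis gives the unique `ρ_P` whose contractions with linear forms
are the coefficient maps; projective covers and exactness carry it to all objects
(`exists_canonicalCoaction`). Contractions separate the elements of `ω(P) ⊗ M`, which gives the
coend property (`existsUnique`), and that property in turn produces the comultiplication and the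
counit.

The equivalence rests on `exists_lift_of_rTensor_eq_zero`, the vanishing criterion with a module `M`
in place of `R`; here flatness enters. It implies that a coaction-stable kernel in `ω(X)` is the
image of a morphism of `C` (`exists_range_eq_ker`). For the graph of a comodule map this gives
fullness. For the kernel of a comodule surjection `ω(X) → E` it exhibits `E` as `ω` of a cokernel;
such surjections exist by counitality and coassociativity of `E` (`exists_hom_apply_eq`). -/

namespace LinearMap

/-- A linear map which vanishes on the kernel of a surjection factors through it. -/
lemma exists_comp_eq_of_ker_le {R : Type*} [CommRing R] {M N P : Type*} [AddCommGroup M]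
    [AddCommGroup N] [AddCommGroup P] [Module R M] [Module R N] [Module R P] {p : M →ₗ[R] N}
    (hp : Function.Surjective p) (g : M →ₗ[R] P) (hg : ∀ m, p m = 0 → g m = 0) :
    ∃ h : N →ₗ[R] P, ∀ m, h (p m) = g m := by
  refine ⟨(LinearMap.ker p).liftQ g (fun m hm => hg m hm) ∘ₗ
    (p.quotKerEquivOfSurjective hp).symm.toLinearMap, fun m => ?_⟩
  have : (p.quotKerEquivOfSurjective hp).symm (p m) = (LinearMap.ker p).mkQ m := by
    rw [LinearEquiv.symm_apply_eq]
    rfl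
  rw [LinearMap.comp_apply, LinearEquiv.coe_coe, this]
  exact Submodule.liftQ_apply _ _ _

end LinearMap

/-! ### Contractions and dual bases -/

namespace TensorProduct

variable {R : Type*} [CommRing R] {E E' : Type*} [AddCommGroup E] [Module R E] [AddCommGroup E']
  [Module R E'] (M : Type*) {N : Type*} [AddCommGroup M] [Module R M] [AddCommGroup N] [Module R N]

/-- Contraction of the left factor of a tensor product with a linear form. -/
noncomputable def contract (φ : E →ₗ[R] R) : E ⊗[R] M →ₗ[R] M :=
  (TensorProduct.lid R M).toLinearMap ∘ₗ φ.rTensor M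

variable {M}

@[simp]
lemma contract_tmul (φ : E →ₗ[R] R) (e : E) (m : M) : contract M φ (e ⊗ₜ m) = φ e • m := by
  simp [contract]

@[simp]
lemma contract_rTensor (φ : E' →ₗ[R] R) (f : E →ₗ[R] E') (z : E ⊗[R] M) :
    contract M φ (f.rTensor M z) = contract M (φ ∘ₗ f) z := by
  induction z with
  | zero => simp
  | tmul => simp
  | add a b ha hb => rw [map_add, map_add, ha, hb, map_add]

@[simp]
lemma contract_lTensor (φ : E →ₗ[R] R) (f : M →ₗ[R] N) (z : E ⊗[R] M) :
    contract N φ (f.lTensor E z) = f (contract M φ z) := by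
  induction z with
  | zero => simp
  | tmul => simp
  | add a b ha hb => rw [map_add, map_add, ha, hb, map_add, map_add]

lemma lTensor_rTensor (f : E →ₗ[R] E') (g : M →ₗ[R] N) (z : E ⊗[R] M) :
    f.rTensor N (g.lTensor E z) = g.lTensor E' (f.rTensor M z) := by
  rw [← LinearMap.comp_apply, ← LinearMap.comp_apply, LinearMap.rTensor_comp_lTensor,
    LinearMap.lTensor_comp_rTensor]

lemma contract_assoc (φ : E →ₗ[R] R) (z : (E ⊗[R] M) ⊗[R] N) :
    contract (M ⊗[R] N) φ (TensorProduct.assoc R E M N z) = (contract M φ).rTensor N z := by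
  refine LinearMap.congr_fun (f := contract (M ⊗[R] N) φ ∘ₗ
    (TensorProduct.assoc R E M N).toLinearMap) (ext_threefold fun e m n => ?_) z
  simp [smul_tmul']

lemma assoc_rTensor_rTensor (f : E →ₗ[R] E') (z : (E ⊗[R] M) ⊗[R] N) :
    TensorProduct.assoc R E' M N ((f.rTensor M).rTensor N z) =
      f.rTensor (M ⊗[R] N) (TensorProduct.assoc R E M N z) := by
  refine LinearMap.congr_fun (f := (TensorProduct.assoc R E' M N).toLinearMap ∘ₗ
    (f.rTensor M).rTensor N) (g := f.rTensor (M ⊗[R] N) ∘ₗ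
    (TensorProduct.assoc R E M N).toLinearMap) (ext_threefold fun e m n => ?_) z
  simp

lemma rTensor_smulRight (φ : E →ₗ[R] R) (e : E') (z : E ⊗[R] M) :
    (φ.smulRight e).rTensor M z = e ⊗ₜ contract M φ z := by
  induction z with
  | zero => simp
  | tmul => simp [smul_tmul]
  | add a b ha hb => rw [map_add, map_add, ha, hb, tmul_add]

/-- A finitely generated projective module has a finite dual basis. -/
lemma _root_.Module.Projective.exists_dualBasis [Module.Finite R E] [Module.Projective R E] :
    ∃ (n : ℕ) (e : Fin n → E) (φ : Fin n → E →ₗ[R] R), ∀ x, ∑ i, φ i x • e i = x := by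
  obtain ⟨n, f, g, -, -, h⟩ := Module.Finite.exists_comp_eq_id_of_projective R E
  refine ⟨n, fun i => f (Pi.single i 1), fun i => LinearMap.proj i ∘ₗ g, fun x => ?_⟩
  conv_rhs => rw [← LinearMap.id_apply (R := R) x, ← h, LinearMap.comp_apply,
    LinearMap.pi_apply_eq_sum_univ f (g x)]
  refine Finset.sum_congr rfl fun i _ => ?_
  refine congrArg (fun t => g x i • f t) (funext fun j => ?_)
  simp [Pi.single_apply, eq_comm]

/-- The elements of `E ⊗ M` are separated by contractions if `E` is finite projective. -/
lemma eq_of_contract_eq [Module.Finite R E] [Module.Projective R E] {z z' : E ⊗[R] M}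
    (h : ∀ φ : E →ₗ[R] R, contract M φ z = contract M φ z') : z = z' := by
  obtain ⟨n, e, φ, hφ⟩ := Module.Projective.exists_dualBasis (R := R) (E := E)
  have key : ∀ z : E ⊗[R] M, z = ∑ i, e i ⊗ₜ[R] contract M (φ i) z := by
    intro z
    induction z with
    | zero => simp
    | tmul x m =>
      conv_lhs => rw [← hφ x, sum_tmul]
      exact Finset.sum_congr rfl fun i _ => by simp [smul_tmul]
    | add a b ha hb =>
      conv_lhs => rw [ha, hb]
      simp [tmul_add, Finset.sum_add_distrib]
  rw [key z, key z']
  simp [h]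

end TensorProduct

/-! ### Exactness of `ω` in terms of elements -/

namespace Reconstruction

variable {R : Type w} [CommRing R] {C : Type u} [Category.{v} C] {ω : C ⥤ FGModuleCat.{w} R}

@[simp]
lemma mapLin_id_apply (X : C) (v : ω.obj X) : mapLin ω (𝟙 X) v = v := by
  simp [mapLin]

@[simp]
lemma mapLin_comp_apply {X Y Z : C} (f : X ⟶ Y) (g : Y ⟶ Z) (v : ω.obj X) :
    mapLin ω (f ≫ g) v = mapLin ω g (mapLin ω f v) := by
  simp [mapLin]

lemma mapLin_comp {X Y Z : C} (f : X ⟶ Y) (g : Y ⟶ Z) :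
    mapLin ω (f ≫ g) = mapLin ω g ∘ₗ mapLin ω f := by
  simp [mapLin]

lemma mapLin_injective [ω.Faithful] {X Y : C} {f g : X ⟶ Y} (h : mapLin ω f = mapLin ω g) :
    f = g :=
  ω.map_injective (FGModuleCat.hom_ext h)

lemma epi_of_mapLin_surjective [ω.Faithful] {X Y : C} (f : X ⟶ Y)
    (hf : Function.Surjective (mapLin ω f)) : Epi f :=
  (ω ⋙ forget₂ (FGModuleCat.{w} R) (ModuleCat.{w} R)).epi_of_epi_map
    ((ModuleCat.epi_iff_surjective _).2 hf)

section Preadditive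

variable [Preadditive C] [ω.Additive]

@[simp]
lemma mapLin_add {X Y : C} (f g : X ⟶ Y) : mapLin ω (f + g) = mapLin ω f + mapLin ω g := by
  rw [mapLin, ω.map_add]
  rfl

@[simp]
lemma mapLin_sub {X Y : C} (f g : X ⟶ Y) : mapLin ω (f - g) = mapLin ω f - mapLin ω g := by
  rw [mapLin, ω.map_sub]
  rfl

@[simp]
lemma mapLin_zero (X Y : C) : mapLin ω (0 : X ⟶ Y) = 0 := by
  rw [mapLin, ω.map_zero]
  rfl

end Preadditive

section Abelian

variable [Abelian C] [IsNoetherianRing R] [PreservesFiniteLimits ω] [PreservesFiniteColimits ω]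

lemma mapLin_surjective_of_epi {X Y : C} (f : X ⟶ Y) [Epi f] :
    Function.Surjective (mapLin ω f) :=
  (ModuleCat.epi_iff_surjective
    ((ω ⋙ forget₂ (FGModuleCat.{w} R) (ModuleCat.{w} R)).map f)).1 inferInstance

variable [ω.Additive]

lemma exists_of_mapLin_eq_zero {X Y Z : C} {f : X ⟶ Y} {g : Y ⟶ Z} (hfg : f ≫ g = 0)
    (h : (ShortComplex.mk f g hfg).Exact) {v : ω.obj Y} (hv : mapLin ω g v = 0) :
    ∃ u, mapLin ω f u = v :=
  (ShortComplex.moduleCat_exact_iff _).1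
    (h.map (ω ⋙ forget₂ (FGModuleCat.{w} R) (ModuleCat.{w} R))) v hv

lemma exists_lift_of_mapLin_eq_zero {X Y : C} (f : X ⟶ Y) {v : ω.obj X}
    (hv : mapLin ω f v = 0) :
    ∃ (K : C) (k : K ⟶ X) (u : ω.obj K), mapLin ω k u = v ∧ k ≫ f = 0 := by
  obtain ⟨u, hu⟩ := exists_of_mapLin_eq_zero (kernel.condition f)
    (ShortComplex.exact_kernel f) hv
  exact ⟨_, kernel.ι f, u, hu, kernel.condition f⟩

end Abelian

end Reconstruction

/-! ### Elements and relations of `L`; torsion-freeness -/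

namespace Reconstruction

open scoped ZeroObject

variable {R : Type w} [CommRing R] {C : Type u} [Category.{v} C] {ω : C ⥤ FGModuleCat.{w} R}

lemma coefficient_mapLin {X Y : C} (f : X ⟶ Y) (φ : ω.obj Y →ₗ[R] R) (v : ω.obj X) :
    coefficient ω Y φ (mapLin ω f v) = coefficient ω X (φ ∘ₗ mapLin ω f) v :=
  LinearMap.congr_fun (IndExt.ι_comp_map ω (dualFunctor ω) f φ) v

lemma coendModule_hom_ext {M : Type*} [AddCommGroup M] [Module R M] {a b : CoendModule ω →ₗ[R] M}
    (h : ∀ (X : C) (φ : ω.obj X →ₗ[R] R) (v : ω.obj X),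
      a (coefficient ω X φ v) = b (coefficient ω X φ v)) : a = b :=
  IndExt.hom_ext ω fun X φ => LinearMap.ext (h X φ)

lemma coendModule_exists_desc {M : Type*} [AddCommGroup M] [Module R M]
    (t : ∀ X : C, (ω.obj X →ₗ[R] R) → (ω.obj X →ₗ[R] M))
    (ht : ∀ (X Y : C) (f : X ⟶ Y) (φ : ω.obj Y →ₗ[R] R) (v : ω.obj X),
      t Y φ (mapLin ω f v) = t X (φ ∘ₗ mapLin ω f) v) :
    ∃ d : CoendModule ω →ₗ[R] M, ∀ (X : C) (φ : ω.obj X →ₗ[R] R) (v : ω.obj X),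
      d (coefficient ω X φ v) = t X φ v := by
  obtain ⟨d, hd⟩ := IndExt.exists_desc ω (G := dualFunctor ω) t
    fun X Y f g => LinearMap.ext (ht X Y f g)
  exact ⟨d, fun X φ v => LinearMap.congr_fun (hd X φ) v⟩

/-- The linear form belonging to an object of the category of elements of `F`. -/
def eltForm (p : Elt (dualFunctor ω)) : ω.obj p.1 →ₗ[R] R := p.2

variable (ω) in
/-- The presentation of `L = ω(F)` as a quotient of a direct sum. -/
noncomputable def quotMap :
    (DirectSum (Elt (dualFunctor ω)) fun p => ω.obj p.1) →ₗ[R] CoendModule ω :=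
  (relations ω (dualFunctor ω)).mkQ

lemma quotMap_surjective : Function.Surjective (quotMap ω) :=
  Submodule.mkQ_surjective _

lemma quotMap_eq_zero {z} : quotMap ω z = 0 ↔ z ∈ relations ω (dualFunctor ω) :=
  Submodule.Quotient.mk_eq_zero _

open Classical in
lemma quotMap_of (p : Elt (dualFunctor ω)) (v : ω.obj p.1) :
    quotMap ω (DirectSum.of (fun p : Elt (dualFunctor ω) => ω.obj p.1) p v) =
      coefficient ω p.1 (eltForm p) v := rfl

lemma mapLin_smul [Preadditive C] [Linear R C] [ω.Linear R] {X Y : C} (r : R) (f : X ⟶ Y) :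
    mapLin ω (r • f) = r • mapLin ω f := by
  rw [mapLin, ω.map_smul]
  rfl

section Abelian

variable [Abelian C] [ω.Additive]

/-- A sum of two elements of `L` as an element coming from a biproduct. -/
lemma coefficient_add {X Y : C} (φ : ω.obj X →ₗ[R] R) (ψ : ω.obj Y →ₗ[R] R) (v : ω.obj X)
    (w : ω.obj Y) :
    coefficient ω (X ⊞ Y) (φ ∘ₗ mapLin ω biprod.fst + ψ ∘ₗ mapLin ω biprod.snd)
      (mapLin ω biprod.inl v + mapLin ω biprod.inr w) =
    coefficient ω X φ v + coefficient ω Y ψ w := by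
  rw [map_add, coefficient_mapLin, coefficient_mapLin]
  congr 3
  all_goals
    rw [LinearMap.add_comp, LinearMap.comp_assoc, LinearMap.comp_assoc, ← mapLin_comp,
      ← mapLin_comp]
    simp only [biprod.inl_fst, biprod.inl_snd, biprod.inr_fst, biprod.inr_snd, mapLin_zero,
      LinearMap.comp_zero, add_zero, zero_add]
    exact LinearMap.ext fun _ => by simp

lemma exists_coefficient_eq (l : CoendModule ω) :
    ∃ (X : C) (φ : ω.obj X →ₗ[R] R) (v : ω.obj X), coefficient ω X φ v = l := by
  classical
  obtain ⟨z, rfl⟩ := quotMap_surjective l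
  induction z using DirectSum.induction_on with
  | zero => exact ⟨0, 0, 0, by simp⟩
  | of p v => exact ⟨p.1, eltForm p, v, (quotMap_of p v).symm⟩
  | add a b ha hb =>
    obtain ⟨X, φ, v, ha⟩ := ha
    obtain ⟨Y, ψ, w, hb⟩ := hb
    exact ⟨_, _, _, (coefficient_add φ ψ v w).trans (by rw [ha, hb, map_add])⟩

/-- An element of the direct sum defining `L = ω(F)` which visibly becomes zero: its components are
the images of one element under morphisms compatible with the linear forms. -/
def IsNull (z : DirectSum (Elt (dualFunctor ω)) fun p => ω.obj p.1) : Prop :=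
  ∃ (K : C) (u : ω.obj K) (k : ∀ p : Elt (dualFunctor ω), K ⟶ p.1)
    (S : Finset (Elt (dualFunctor ω))), (∀ p ∉ S, k p = 0) ∧
    (∀ a : ω.obj K, ∑ p ∈ S, eltForm p (mapLin ω (k p) a) = 0) ∧
    ∀ p, z p = mapLin ω (k p) u

/-- Null elements contain the generating relations and are closed under sums (by biproducts) and
scalars. The forms are required to cancel on all of `ω(K)`, not only at `u`, so that the condition
survives restriction along any `K' ⟶ K`. -/
lemma isNull_of_mem_relations
    {z : DirectSum (Elt (dualFunctor ω)) fun p => ω.obj p.1}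
    (hz : z ∈ relations ω (dualFunctor ω)) : IsNull z := by
  classical
  unfold relations at hz
  induction hz using Submodule.span_induction with
  | zero => exact ⟨0, 0, 0, ∅, by simp, by simp, by simp⟩
  | mem z hz =>
    obtain ⟨X, Y, f, φ, v, rfl⟩ := hz
    set a : Elt (dualFunctor ω) := ⟨X, (dualFunctor ω).map f.op φ⟩ with ha
    set b : Elt (dualFunctor ω) := ⟨Y, φ⟩ with hb
    -- The indices `a` and `b` may coincide; taking the difference of two separate families covers
    -- that case too.
    let ka : ∀ p : Elt (dualFunctor ω), X ⟶ p.1 := Pi.single a (𝟙 X)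
    let kb : ∀ p : Elt (dualFunctor ω), X ⟶ p.1 := Pi.single b f
    refine ⟨X, v, fun p => ka p - kb p, {a, b}, fun p hp => ?_, fun y => ?_, fun p => ?_⟩
    · simp only [Finset.mem_insert, Finset.mem_singleton, not_or] at hp
      simp [ka, kb, hp.1, hp.2]
    · simp only [mapLin_sub, LinearMap.sub_apply, map_sub, Finset.sum_sub_distrib]
      rw [Finset.sum_eq_single a, Finset.sum_eq_single b]
      · simp only [ka, kb, Pi.single_eq_same, mapLin_id_apply]
        exact sub_self (eltForm b (mapLin ω f y))
      · intro p _ hp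
        simp [kb, hp]
      · simp
      · intro p _ hp
        simp [ka, hp]
      · simp
    · rw [DirectSum.sub_apply, mapLin_sub, LinearMap.sub_apply]
      congr 1
      · by_cases hp : p = a
        · subst hp
          rw [DirectSum.lof_eq_of]
          exact (DirectSum.of_eq_same (β := fun p : Elt (dualFunctor ω) => ω.obj p.1) a v).trans (by simp [ka])
        · rw [DirectSum.lof_eq_of, DirectSum.of_eq_of_ne _ _ _ hp]
          simp [ka, hp]
      · by_cases hp : p = b
        · subst hp
          rw [DirectSum.lof_eq_of]
          exact (DirectSum.of_eq_same (β := fun p : Elt (dualFunctor ω) => ω.obj p.1) b _).trans (by simp [kb])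
        · rw [DirectSum.lof_eq_of, DirectSum.of_eq_of_ne _ _ _ hp]
          simp [kb, hp]
  | add y z _ _ hy hz =>
    obtain ⟨K, u, k, S, h₁, h₂, h₃⟩ := hy
    obtain ⟨K', u', k', S', h₁', h₂', h₃'⟩ := hz
    refine ⟨K ⊞ K', mapLin ω biprod.inl u + mapLin ω biprod.inr u',
      fun p => biprod.desc (k p) (k' p), S ∪ S', fun p hp => ?_, fun a => ?_, fun p => ?_⟩
    · simp only [Finset.mem_union, not_or] at hp
      ext <;> simp [h₁ p hp.1, h₁' p hp.2]
    · have e : ∀ p, biprod.desc (k p) (k' p) = biprod.fst ≫ k p + biprod.snd ≫ k' p := fun p => by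
        ext <;> simp
      simp only [e, mapLin_add, LinearMap.add_apply, map_add, Finset.sum_add_distrib,
        mapLin_comp_apply]
      rw [← Finset.sum_subset Finset.subset_union_left, ← Finset.sum_subset
        Finset.subset_union_right, h₂, h₂', add_zero]
      · intro p _ hp
        simp [h₁' p hp]
      · intro p _ hp
        simp [h₁ p hp]
    · rw [DirectSum.add_apply, h₃, h₃', map_add, ← mapLin_comp_apply, ← mapLin_comp_apply]
      simp
  | smul r z _ hz =>
    obtain ⟨K, u, k, S, h₁, h₂, h₃⟩ := hz
    exact ⟨K, r • u, k, S, h₁, h₂, fun p => by rw [DirectSum.smul_apply, h₃, map_smul]⟩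

variable [IsNoetherianRing R] [PreservesFiniteLimits ω] [PreservesFiniteColimits ω]

/-- A finite number of morphisms killing an element are simultaneously killed by a morphism through
which the element factors. -/
lemma exists_lift_of_forall_mapLin_eq_zero {ι : Type*} {X : C} {Y : ι → C} (f : ∀ i, X ⟶ Y i)
    {v : ω.obj X} (S : Finset ι) (hv : ∀ i ∈ S, mapLin ω (f i) v = 0) :
    ∃ (K : C) (k : K ⟶ X) (u : ω.obj K), mapLin ω k u = v ∧ ∀ i ∈ S, k ≫ f i = 0 := by
  classical
  induction S using Finset.induction_on with
  | empty => exact ⟨X, 𝟙 X, v, by simp, by simp⟩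
  | insert i S _ ih =>
    obtain ⟨K, k, u, rfl, h⟩ := ih fun i hi => hv i (Finset.mem_insert_of_mem hi)
    have hi := hv i (Finset.mem_insert_self i S)
    rw [← mapLin_comp_apply] at hi
    obtain ⟨K', k', u', rfl, h'⟩ := exists_lift_of_mapLin_eq_zero _ hi
    refine ⟨K', k' ≫ k, u', by simp, fun j hj => ?_⟩
    obtain rfl | hj := Finset.mem_insert.1 hj
    · simpa using h'
    · simp [h j hj]

/-- A null presentation of `v` placed at `(X, φ)` has `ω(k p) u = 0` for every `p ≠ (X, φ)`.
Shrinking `K` until these finitely many `k p` vanish leaves only the term of `φ` in the cancelling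
sum. -/
lemma exists_lift_of_coefficient_eq_zero {X : C} {φ : ω.obj X →ₗ[R] R} {v : ω.obj X}
    (h : coefficient ω X φ v = 0) :
    ∃ (K : C) (k : K ⟶ X) (u : ω.obj K), mapLin ω k u = v ∧ φ ∘ₗ mapLin ω k = 0 := by
  classical
  let a : Elt (dualFunctor ω) := ⟨X, φ⟩
  have h : quotMap ω (DirectSum.of (fun p : Elt (dualFunctor ω) => ω.obj p.1) a v) = 0 :=
    (quotMap_of a v).trans h
  obtain ⟨K, u, k, S, h₁, h₂, h₃⟩ := isNull_of_mem_relations (quotMap_eq_zero.1 h)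
  obtain ⟨K', k', u', rfl, h'⟩ := exists_lift_of_forall_mapLin_eq_zero k (v := u) (S.erase a)
    fun p hp => by rw [← h₃, DirectSum.of_eq_of_ne _ _ _ (Finset.ne_of_mem_erase hp)]
  refine ⟨K', k' ≫ k a, u', ?_, LinearMap.ext fun y => ?_⟩
  · rw [mapLin_comp_apply, ← h₃, DirectSum.of_eq_same]
  · have hy := h₂ (mapLin ω k' y)
    rw [Finset.sum_eq_single a] at hy
    · rw [LinearMap.comp_apply, mapLin_comp_apply]
      exact hy
    · intro p hp hpa
      rw [← mapLin_comp_apply, h' p (Finset.mem_erase.2 ⟨hpa, hp⟩)]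
      simp
    · intro ha
      simp [h₁ a ha]

variable [Linear R C] [ω.Linear R]

/-- `L = ω(F)` is torsion-free. -/
lemma coendModule_isTorsionFree [IsDomain R] : Module.IsTorsionFree R (CoendModule ω) := by
  refine Module.isTorsionFree_iff_smul_eq_zero.2 fun r l hl => ?_
  by_cases hr : r = 0
  · exact Or.inl hr
  refine Or.inr ?_
  obtain ⟨X, φ, v, rfl⟩ := exists_coefficient_eq l
  rw [← map_smul] at hl
  obtain ⟨K, k, u, hu, hk⟩ := exists_lift_of_coefficient_eq_zero hl
  have hz : mapLin ω (cokernel.π k) (r • v) = 0 := by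
    rw [← hu, ← mapLin_comp_apply, cokernel.condition, mapLin_zero, LinearMap.zero_apply]
  rw [map_smul, ← LinearMap.smul_apply, ← mapLin_smul] at hz
  -- `K'` maps into the kernel of `r • cokernel.π k`, where multiplication by `r` lands in the image
  -- of `ω(k)`. Hence `r φ` vanishes on the image of `ω(k')`, and so does `φ`, as `R` is a domain.
  obtain ⟨K', k', u', rfl, hk'⟩ := exists_lift_of_mapLin_eq_zero _ hz
  have hφ : φ ∘ₗ mapLin ω k' = 0 := LinearMap.ext fun y => by
    have hy : mapLin ω (cokernel.π k) (r • mapLin ω k' y) = 0 := by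
      rw [map_smul, ← LinearMap.smul_apply, ← mapLin_smul, ← mapLin_comp_apply, hk',
        mapLin_zero, LinearMap.zero_apply]
    obtain ⟨t, ht⟩ := exists_of_mapLin_eq_zero (cokernel.condition k)
      (ShortComplex.exact_cokernel k) hy
    have := congrArg φ ht
    rw [map_smul, ← LinearMap.comp_apply, hk, LinearMap.zero_apply, eq_comm, smul_eq_mul,
      mul_eq_zero] at this
    exact this.resolve_left hr
  rw [coefficient_mapLin, hφ]
  -- The zero form is pulled back from the zero object.
  simpa using (coefficient_mapLin (ω := ω) (0 : K' ⟶ 0) 0 u').symm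

end Abelian
end Reconstruction

/-! ### Canonical coactions, the coend property and the coalgebra structure -/

namespace Reconstruction

variable {R : Type w} [CommRing R] {C : Type u} [Category.{v} C] {ω : C ⥤ FGModuleCat.{w} R}

lemma rTensor_mapLin_comp {M : Type*} [AddCommGroup M] [Module R M] {X Y Z : C} (f : X ⟶ Y)
    (g : Y ⟶ Z) (z : ω.obj X ⊗[R] M) :
    (mapLin ω (f ≫ g)).rTensor M z = (mapLin ω g).rTensor M ((mapLin ω f).rTensor M z) := by
  rw [mapLin_comp, LinearMap.rTensor_comp_apply]

variable (ω) in
/-- Every object is a quotient of an object whose image under `ω` is projective. -/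
def HasProjectiveCovers : Prop :=
  ∀ X : C, ∃ (P : C) (p : P ⟶ X), Module.Projective R (ω.obj P) ∧ Epi p

lemma IsSubcategoryOfDefinition.hasProjectiveCovers {C₀ : ObjectProperty C}
    (h : IsSubcategoryOfDefinition ω C₀) : HasProjectiveCovers ω := fun X => by
  obtain ⟨P, p, hP, hp⟩ := h.exists_epi X
  exact ⟨P, p, h.projective P hP, hp⟩

/-- The canonical coactions `ω(X) → ω(X) ⊗ L` of `L = ω(F)`. -/
structure IsCanonicalCoaction (ρ : ∀ X : C, ω.obj X →ₗ[R] ω.obj X ⊗[R] CoendModule ω) :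
    Prop where
  natural : ∀ {X Y : C} (f : X ⟶ Y) (v : ω.obj X),
    ρ Y (mapLin ω f v) = (mapLin ω f).rTensor (CoendModule ω) (ρ X v)
  contract : ∀ {X : C} (φ : ω.obj X →ₗ[R] R) (v : ω.obj X),
    contract (CoendModule ω) φ (ρ X v) = coefficient ω X φ v

/-- The maps `ω(X) → ω(X) ⊗ L` are coassociative and counital. -/
structure IsComoduleStructure [Coalgebra R (CoendModule ω)]
    (ρ : ∀ X : C, ω.obj X →ₗ[R] ω.obj X ⊗[R] CoendModule ω) : Prop where
  coassoc : ∀ (X : C) (v : ω.obj X), TensorProduct.assoc R _ _ _ ((ρ X).rTensor _ (ρ X v)) =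
    (Coalgebra.comul (R := R) (A := CoendModule ω)).lTensor (ω.obj X) (ρ X v)
  counit : ∀ (X : C) (v : ω.obj X),
    (Coalgebra.counit (R := R) (A := CoendModule ω)).lTensor (ω.obj X) (ρ X v) = v ⊗ₜ 1

section Existence

variable [Abelian C]

/-- Linearity in the form is not imposed in the colimit; it follows from naturality along `r • 𝟙 X`,
which pulls `φ` back to `r • φ`. -/
lemma coefficient_smul_form [Linear R C] [ω.Linear R] {X : C} (r : R) (φ : ω.obj X →ₗ[R] R) (v : ω.obj X) :
    coefficient ω X (r • φ) v = r • coefficient ω X φ v := by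
  have h := coefficient_mapLin (ω := ω) (r • 𝟙 X) φ v
  rw [mapLin_smul, LinearMap.smul_apply, map_smul, mapLin_id_apply] at h
  rw [h]
  congr 2
  exact LinearMap.ext fun _ => by simp

variable [ω.Additive]

/-- Naturality along the diagonal `X ⟶ X ⊞ X`, which pulls `φ ∘ fst + ψ ∘ snd` back to `φ + ψ`. -/
lemma coefficient_add_form {X : C} (φ ψ : ω.obj X →ₗ[R] R) (v : ω.obj X) :
    coefficient ω X (φ + ψ) v = coefficient ω X φ v + coefficient ω X ψ v := by
  have hd : biprod.lift (𝟙 X) (𝟙 X) = biprod.inl + biprod.inr := by ext <;> simp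
  have h := coefficient_mapLin (ω := ω) (biprod.lift (𝟙 X) (𝟙 X))
    (φ ∘ₗ mapLin ω biprod.fst + ψ ∘ₗ mapLin ω biprod.snd) v
  rw [LinearMap.add_comp, LinearMap.comp_assoc, LinearMap.comp_assoc, ← mapLin_comp,
    ← mapLin_comp, biprod.lift_fst, biprod.lift_snd, hd, mapLin_add, LinearMap.add_apply,
    coefficient_add] at h
  rw [h]
  congr 2
  exact LinearMap.ext fun _ => by simp

variable [Linear R C] [ω.Linear R]

variable (ω) in
/-- The coefficient maps, as a bilinear map. -/
noncomputable def coefficientBilin (X : C) :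
    (ω.obj X →ₗ[R] R) →ₗ[R] ω.obj X →ₗ[R] CoendModule ω where
  toFun φ := coefficient ω X φ
  map_add' φ ψ := LinearMap.ext (coefficient_add_form φ ψ)
  map_smul' r φ := LinearMap.ext (coefficient_smul_form r φ)

/-- On an object with projective image there is a canonical coaction. -/
lemma exists_coaction_of_projective (P : C) [Module.Projective R (ω.obj P)] :
    ∃ ρ : ω.obj P →ₗ[R] ω.obj P ⊗[R] CoendModule ω, ∀ (φ : ω.obj P →ₗ[R] R) (v : ω.obj P),
      contract (CoendModule ω) φ (ρ v) = coefficient ω P φ v := by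
  obtain ⟨n, e, φ, hφ⟩ := Module.Projective.exists_dualBasis (R := R) (E := ω.obj P)
  -- The only possible choice: a tensor is the sum of the `e i ⊗ -` of its contractions with the `φ
  -- i`.
  refine ⟨∑ i, TensorProduct.mk R _ _ (e i) ∘ₗ coefficient ω P (φ i), fun ψ v => ?_⟩
  have hψ : ψ = ∑ i, ψ (e i) • φ i := LinearMap.ext fun x => by
    conv_lhs => rw [← hφ x]
    simp [mul_comm]
  have : coefficientBilin ω P ψ v = ∑ i, ψ (e i) • coefficientBilin ω P (φ i) v := by
    conv_lhs => rw [hψ]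
    simp
  refine Eq.trans ?_ this.symm
  simp [coefficientBilin]

/-- The canonical coactions exist. -/
lemma exists_canonicalCoaction [IsNoetherianRing R] [PreservesFiniteLimits ω]
    [PreservesFiniteColimits ω] (hω : HasProjectiveCovers ω) :
    ∃ ρ : ∀ X : C, ω.obj X →ₗ[R] ω.obj X ⊗[R] CoendModule ω, IsCanonicalCoaction ρ := by
  have hP : ∀ P : C, Module.Projective R (ω.obj P) →
      ∃ ρ : ω.obj P →ₗ[R] ω.obj P ⊗[R] CoendModule ω, ∀ (φ : ω.obj P →ₗ[R] R) (v : ω.obj P),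
        contract (CoendModule ω) φ (ρ v) = coefficient ω P φ v :=
    fun P _ => exists_coaction_of_projective P
  choose ρ₀ hρ₀ using hP
  have nat₀ : ∀ {P Q : C} (hP : Module.Projective R (ω.obj P))
      (hQ : Module.Projective R (ω.obj Q)) (f : P ⟶ Q) (v : ω.obj P),
      ρ₀ Q hQ (mapLin ω f v) = (mapLin ω f).rTensor (CoendModule ω) (ρ₀ P hP v) :=
    fun hP hQ f v => eq_of_contract_eq fun φ => by
      rw [hρ₀, contract_rTensor, hρ₀, coefficient_mapLin]
  have hX : ∀ X : C, ∃ ρ : ω.obj X →ₗ[R] ω.obj X ⊗[R] CoendModule ω,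
      ∀ (P : C) (hP : Module.Projective R (ω.obj P)) (f : P ⟶ X) (v : ω.obj P),
        ρ (mapLin ω f v) = (mapLin ω f).rTensor (CoendModule ω) (ρ₀ P hP v) := by
    intro X
    obtain ⟨P₀, p, hP₀, hp⟩ := hω X
    -- Descent along one cover `p`: each element of the kernel of `ω(p)` comes from an object `Q`
    -- with projective image and zero composite to `X`, so naturality on projectives kills its
    -- contribution.
    obtain ⟨ρ, hρ⟩ := LinearMap.exists_comp_eq_of_ker_le (mapLin_surjective_of_epi (ω := ω) p)
      ((mapLin ω p).rTensor (CoendModule ω) ∘ₗ ρ₀ P₀ hP₀) fun v hv => by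
        obtain ⟨K, k, w, rfl, hk⟩ := exists_lift_of_mapLin_eq_zero p hv
        obtain ⟨Q, q, hQ, hq⟩ := hω K
        obtain ⟨t, rfl⟩ := mapLin_surjective_of_epi q w
        rw [LinearMap.comp_apply, ← mapLin_comp_apply, nat₀ hQ hP₀, ← rTensor_mapLin_comp,
          Category.assoc, hk, comp_zero, mapLin_zero, LinearMap.rTensor_zero,
          LinearMap.zero_apply]
    refine ⟨ρ, fun P hP f v => ?_⟩
    -- An arbitrary `f` is compared with the chosen cover `p` on a cover of their pullback, which
    -- still maps onto `P`.
    obtain ⟨Q, q, hQ, hq⟩ := hω (pullback f p)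
    have := Abelian.epi_pullback_of_epi_g f p
    obtain ⟨t, rfl⟩ := mapLin_surjective_of_epi (q ≫ pullback.fst f p) v
    rw [← mapLin_comp_apply, nat₀ hQ hP, ← rTensor_mapLin_comp, Category.assoc,
      pullback.condition, ← Category.assoc, mapLin_comp_apply, hρ, LinearMap.comp_apply,
      nat₀ hQ hP₀, ← rTensor_mapLin_comp]
  choose ρ hρ using hX
  refine ⟨ρ, @fun X Y f v => ?_, @fun X φ v => ?_⟩
  all_goals
    obtain ⟨P, p, hP, hp⟩ := hω X
    obtain ⟨t, rfl⟩ := mapLin_surjective_of_epi p v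
  · rw [← mapLin_comp_apply, hρ Y P hP, hρ X P hP, rTensor_mapLin_comp]
  · rw [hρ X P hP, contract_rTensor, hρ₀, coefficient_mapLin]

end Existence

namespace IsCanonicalCoaction

variable {ρ : ∀ X : C, ω.obj X →ₗ[R] ω.obj X ⊗[R] CoendModule ω} (h : IsCanonicalCoaction ρ)

include h

/-- The coend property of the canonical coactions. -/
lemma existsUnique [Abelian C] [IsNoetherianRing R] [PreservesFiniteLimits ω]
    [PreservesFiniteColimits ω] (hω : HasProjectiveCovers ω) {M : Type*} [AddCommGroup M]
    [Module R M] (t : ∀ X : C, ω.obj X →ₗ[R] ω.obj X ⊗[R] M)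
    (ht : ∀ (X Y : C) (f : X ⟶ Y), t Y ∘ₗ mapLin ω f = (mapLin ω f).rTensor M ∘ₗ t X) :
    ∃! f : CoendModule ω →ₗ[R] M, ∀ X : C, t X = f.lTensor (ω.obj X) ∘ₗ ρ X := by
  have ht (X Y : C) (f : X ⟶ Y) (v : ω.obj X) :
      t Y (mapLin ω f v) = (mapLin ω f).rTensor M (t X v) := LinearMap.congr_fun (ht X Y f) v
  obtain ⟨d, hd⟩ := coendModule_exists_desc (ω := ω)
    (fun X φ => TensorProduct.contract M φ ∘ₗ t X) fun X Y f φ v => by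
      simp only [LinearMap.comp_apply]
      rw [ht, contract_rTensor]
  refine ⟨d, fun X => LinearMap.ext fun v => ?_, fun f hf => coendModule_hom_ext fun X φ v => ?_⟩
  -- Contractions need not separate the elements of `ω(X) ⊗ M`, so the identity is checked on a
  -- cover with projective image.
  · obtain ⟨P, p, hP, hp⟩ := hω X
    obtain ⟨a, rfl⟩ := mapLin_surjective_of_epi p v
    have ha : t P a = d.lTensor (ω.obj P) (ρ P a) := eq_of_contract_eq fun φ => by
      rw [contract_lTensor, h.contract, hd, LinearMap.comp_apply]
    rw [ht, ha, LinearMap.comp_apply, h.natural, lTensor_rTensor]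
  · rw [hd, LinearMap.comp_apply, hf X, LinearMap.comp_apply, contract_lTensor, h.contract]

variable [Abelian C] [IsNoetherianRing R] [PreservesFiniteLimits ω] [PreservesFiniteColimits ω]
  (hω : HasProjectiveCovers ω)

include hω

/-- The coend property applied to the iterated coaction `(ρ ⊗ id) ∘ ρ`. -/
lemma exists_comul : ∃ Δ : CoendModule ω →ₗ[R] CoendModule ω ⊗[R] CoendModule ω,
    ∀ (X : C) (v : ω.obj X), TensorProduct.assoc R _ _ _ ((ρ X).rTensor _ (ρ X v)) =
      Δ.lTensor (ω.obj X) (ρ X v) := by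
  obtain ⟨Δ, hΔ, -⟩ := h.existsUnique hω
    (fun X => (TensorProduct.assoc R _ _ _).toLinearMap ∘ₗ (ρ X).rTensor _ ∘ₗ ρ X)
    fun X Y f => LinearMap.ext fun v => by
      simp only [LinearMap.comp_apply, LinearEquiv.coe_coe]
      rw [h.natural, ← LinearMap.rTensor_comp_apply,
        show ρ Y ∘ₗ mapLin ω f = (mapLin ω f).rTensor _ ∘ₗ ρ X from LinearMap.ext (h.natural f),
        LinearMap.rTensor_comp_apply, assoc_rTensor_rTensor]
  exact ⟨Δ, fun X v => LinearMap.congr_fun (hΔ X) v⟩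

/-- The coend property applied to `v ↦ v ⊗ 1`. -/
lemma exists_counit : ∃ ε : CoendModule ω →ₗ[R] R,
    ∀ (X : C) (v : ω.obj X), ε.lTensor (ω.obj X) (ρ X v) = v ⊗ₜ 1 := by
  obtain ⟨ε, hε, -⟩ := h.existsUnique hω
    (fun X => (TensorProduct.rid R (ω.obj X)).symm.toLinearMap)
    fun X Y f => LinearMap.ext fun v => by simp
  exact ⟨ε, fun X v => (LinearMap.congr_fun (hε X) v).symm⟩

/-- `L = ω(F)` is a coalgebra, and the canonical coactions are comodule structures. -/
lemma exists_coalgebra : ∃ _ : Coalgebra R (CoendModule ω),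
    IsComoduleStructure ρ ∧
    ∀ (X : C) (φ : ω.obj X →ₗ[R] R) (v : ω.obj X),
      Coalgebra.counit (R := R) (coefficient ω X φ v) = φ v := by
  obtain ⟨Δ, hΔ⟩ := h.exists_comul hω
  obtain ⟨ε, hε⟩ := h.exists_counit hω
  -- Contracting the first factor turns the defining property of `Δ` into a formula on coefficients,
  -- where the coalgebra axioms can be tested.
  have hΔc (X : C) (φ : ω.obj X →ₗ[R] R) (v : ω.obj X) :
      Δ (coefficient ω X φ v) = (coefficient ω X φ).rTensor _ (ρ X v) := by
    rw [← h.contract, ← contract_lTensor, ← hΔ, contract_assoc, ← LinearMap.rTensor_comp_apply]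
    congr 2
    exact LinearMap.ext (h.contract φ)
  have hεc (X : C) (φ : ω.obj X →ₗ[R] R) (v : ω.obj X) : ε (coefficient ω X φ v) = φ v := by
    rw [← h.contract, ← contract_lTensor, hε, contract_tmul, smul_eq_mul, mul_one]
  have hΔc' (X : C) (φ : ω.obj X →ₗ[R] R) :
      Δ ∘ₗ coefficient ω X φ = (coefficient ω X φ).rTensor _ ∘ₗ ρ X := LinearMap.ext (hΔc X φ)
  let c : Coalgebra R (CoendModule ω) :=
    { comul := Δ, counit := ε, coassoc := ?_, rTensor_counit_comp_comul := ?_,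
      lTensor_counit_comp_comul := ?_ }
  · exact ⟨c, ⟨hΔ, hε⟩, hεc⟩
  all_goals refine coendModule_hom_ext fun X φ v => ?_
  · simp only [LinearMap.comp_apply, LinearEquiv.coe_coe]
    rw [hΔc, ← LinearMap.rTensor_comp_apply, hΔc', LinearMap.rTensor_comp_apply,
      assoc_rTensor_rTensor, hΔ, lTensor_rTensor]
  · rw [LinearMap.comp_apply, hΔc, ← LinearMap.rTensor_comp_apply,
      show ε ∘ₗ coefficient ω X φ = φ from LinearMap.ext (hεc X φ)]
    apply (TensorProduct.lid R (CoendModule ω)).injective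
    exact (h.contract φ v).trans (by simp)
  · rw [LinearMap.comp_apply, hΔc, ← lTensor_rTensor, hε]
    simp

end IsCanonicalCoaction

end Reconstruction

/-! ### Kernels of `ω(X) → M ⊗ L` and fullness -/

namespace Reconstruction

open scoped ZeroObject

variable {R : Type w} [CommRing R] {C : Type u} [Category.{v} C] {ω : C ⥤ FGModuleCat.{w} R}

section Abelian

variable [Abelian C] [ω.Additive]

lemma mapLin_fst_inl_add_inr {X Y : C} (v : ω.obj X) (w : ω.obj Y) :
    mapLin ω (biprod.fst : X ⊞ Y ⟶ X) (mapLin ω biprod.inl v + mapLin ω biprod.inr w) = v := by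
  rw [map_add, ← mapLin_comp_apply, ← mapLin_comp_apply]
  simp

lemma mapLin_snd_inl_add_inr {X Y : C} (v : ω.obj X) (w : ω.obj Y) :
    mapLin ω (biprod.snd : X ⊞ Y ⟶ Y) (mapLin ω biprod.inl v + mapLin ω biprod.inr w) = w := by
  rw [map_add, ← mapLin_comp_apply, ← mapLin_comp_apply]
  simp

lemma exists_lift_of_forall_coefficient_eq_zero [IsNoetherianRing R] [PreservesFiniteLimits ω]
    [PreservesFiniteColimits ω] {ι : Type*} {X : C} (φ : ι → ω.obj X →ₗ[R] R) {v : ω.obj X}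
    (S : Finset ι) (hv : ∀ i ∈ S, coefficient ω X (φ i) v = 0) :
    ∃ (K : C) (k : K ⟶ X) (u : ω.obj K), mapLin ω k u = v ∧ ∀ i ∈ S, φ i ∘ₗ mapLin ω k = 0 := by
  classical
  induction S using Finset.induction_on with
  | empty => exact ⟨X, 𝟙 X, v, by simp, by simp⟩
  | insert i S _ ih =>
    obtain ⟨K, k, u, rfl, h⟩ := ih fun i hi => hv i (Finset.mem_insert_of_mem hi)
    have hi := hv i (Finset.mem_insert_self i S)
    rw [coefficient_mapLin] at hi
    obtain ⟨K', k', u', rfl, h'⟩ := exists_lift_of_coefficient_eq_zero hi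
    refine ⟨K', k' ≫ k, u', by simp, fun j hj => ?_⟩
    rw [mapLin_comp, ← LinearMap.comp_assoc]
    obtain rfl | hj := Finset.mem_insert.1 hj
    · exact h'
    · rw [h j hj, LinearMap.zero_comp]

namespace IsCanonicalCoaction

variable {ρ : ∀ X : C, ω.obj X →ₗ[R] ω.obj X ⊗[R] CoendModule ω} (h : IsCanonicalCoaction ρ)

include h

omit [Abelian C] [ω.Additive] in
lemma rTensor_comp_mapLin {X Y : C} {M : Type*} [AddCommGroup M] [Module R M]
    (χ : ω.obj Y →ₗ[R] M) (f : X ⟶ Y) (v : ω.obj X) :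
    (χ ∘ₗ mapLin ω f).rTensor _ (ρ X v) = χ.rTensor _ (ρ Y (mapLin ω f v)) := by
  rw [h.natural, LinearMap.rTensor_comp_apply]

/-- A pair `(χ, v)` represents the element `(χ ⊗ id)(ρ v)` of `M ⊗ L`, just as `(φ, v)` represents a
coefficient when `M = R`; biproducts again realise sums. -/
lemma rTensor_biprod {X Y : C} {M : Type*} [AddCommGroup M] [Module R M]
    (χ : ω.obj X →ₗ[R] M) (χ' : ω.obj Y →ₗ[R] M) (v : ω.obj X) (w : ω.obj Y) :
    (χ ∘ₗ mapLin ω biprod.fst + χ' ∘ₗ mapLin ω biprod.snd).rTensor (CoendModule ω)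
      (ρ (X ⊞ Y) (mapLin ω biprod.inl v + mapLin ω biprod.inr w)) =
    χ.rTensor _ (ρ X v) + χ'.rTensor _ (ρ Y w) := by
  rw [LinearMap.rTensor_add, LinearMap.add_apply, h.rTensor_comp_mapLin, h.rTensor_comp_mapLin,
    mapLin_fst_inl_add_inr, mapLin_snd_inl_add_inr]

/-- Every element of `M ⊗ L` comes from some `ω(X)`. -/
lemma exists_rTensor_eq {M : Type*} [AddCommGroup M] [Module R M] (z : M ⊗[R] CoendModule ω) :
    ∃ (X : C) (χ : ω.obj X →ₗ[R] M) (v : ω.obj X), χ.rTensor _ (ρ X v) = z := by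
  induction z with
  | zero => exact ⟨0, 0, 0, by simp⟩
  | tmul m l =>
    obtain ⟨X, φ, v, rfl⟩ := exists_coefficient_eq l
    exact ⟨X, φ.smulRight m, v, by rw [rTensor_smulRight, h.contract]⟩
  | add a b ha hb =>
    obtain ⟨X, χ, v, rfl⟩ := ha
    obtain ⟨Y, χ', w, rfl⟩ := hb
    exact ⟨_, _, _, h.rTensor_biprod χ χ' v w⟩

variable [IsNoetherianRing R] [PreservesFiniteLimits ω] [PreservesFiniteColimits ω]
  (hω : HasProjectiveCovers ω) [Module.Flat R (CoendModule ω)]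

include hω

/-- The kernel of `ω(X) → M ⊗ L` consists of the elements coming from morphisms to `X` which are
killed by `ψ`. -/
lemma exists_lift_of_rTensor_eq_zero {X : C} {M : Type*} [AddCommGroup M] [Module R M]
    (ψ : ω.obj X →ₗ[R] M) {v : ω.obj X} (hv : ψ.rTensor (CoendModule ω) (ρ X v) = 0) :
    ∃ (K : C) (k : K ⟶ X) (u : ω.obj K), mapLin ω k u = v ∧ ψ ∘ₗ mapLin ω k = 0 := by
  -- Flatness of `L` allows `M` to be replaced by the finitely generated range of `ψ`.
  have hv' : ψ.rangeRestrict.rTensor (CoendModule ω) (ρ X v) = 0 := by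
    apply Module.Flat.rTensor_preserves_injective_linearMap (M := CoendModule ω)
      (LinearMap.range ψ).subtype Subtype.val_injective
    rw [← LinearMap.rTensor_comp_apply, map_zero]
    exact hv
  obtain ⟨P, p, hP, hp⟩ := hω X
  obtain ⟨a, rfl⟩ := mapLin_surjective_of_epi p v
  obtain ⟨n, π, hπ⟩ := Module.Finite.exists_fin' R (LinearMap.range ψ)
  obtain ⟨φ, hφ⟩ := Module.projective_lifting_property π (ψ.rangeRestrict ∘ₗ mapLin ω p) hπ
  have ha : π.rTensor (CoendModule ω) (φ.rTensor (CoendModule ω) (ρ P a)) = 0 := by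
    rw [← LinearMap.rTensor_comp_apply, hφ, h.rTensor_comp_mapLin, hv']
  -- By right exactness the element of `R^n ⊗ L` comes from `ker π ⊗ L`, where it is again
  -- represented by an object `Q`.
  obtain ⟨y, hy⟩ := (rTensor_exact (CoendModule ω)
    (LinearMap.exact_subtype_ker_map π) hπ _).1 ha
  obtain ⟨Q, χ, w, rfl⟩ := h.exists_rTensor_eq y
  set χ' := (LinearMap.ker π).subtype ∘ₗ χ with hχ'
  have hy' : χ'.rTensor (CoendModule ω) (ρ Q w) = φ.rTensor (CoendModule ω) (ρ P a) := by
    rw [hχ', LinearMap.rTensor_comp_apply, hy]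
  have hz := h.rTensor_biprod φ (-χ') a w
  rw [LinearMap.rTensor_neg, LinearMap.neg_apply, hy', add_neg_cancel] at hz
  -- The `n` coordinates of `φ ∘ fst - χ' ∘ snd` are ordinary linear forms with vanishing
  -- coefficients. On `K` this gives `φ ∘ fst = χ' ∘ snd`, and `π` kills the right side and sends
  -- the left to `ψ`.
  obtain ⟨K, k, u, hu, hk⟩ := exists_lift_of_forall_coefficient_eq_zero
    (fun i : Fin n => LinearMap.proj i ∘ₗ
      (φ ∘ₗ mapLin ω biprod.fst + (-χ') ∘ₗ mapLin ω biprod.snd)) Finset.univ fun i _ => by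
      rw [← h.contract, ← contract_rTensor, hz, map_zero]
  refine ⟨K, k ≫ biprod.fst ≫ p, u, ?_, LinearMap.ext fun t => ?_⟩
  · rw [mapLin_comp_apply, mapLin_comp_apply, hu, mapLin_fst_inl_add_inr]
  · have ht : φ (mapLin ω biprod.fst (mapLin ω k t)) =
        χ (mapLin ω biprod.snd (mapLin ω k t)) := by
      funext i
      have := LinearMap.congr_fun (hk i (Finset.mem_univ i)) t
      simpa [hχ', add_neg_eq_zero] using this
    have := LinearMap.congr_fun hφ (mapLin ω biprod.fst (mapLin ω k t))
    rw [LinearMap.comp_apply, ht, (χ _).2] at this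
    simpa using (congrArg Subtype.val this).symm

/-- If the kernel of `ψ` is stable under the coaction, then it is the image of a morphism. -/
lemma exists_range_eq_ker {X : C} {M : Type*} [AddCommGroup M] [Module R M]
    (ψ : ω.obj X →ₗ[R] M) (hψ : ∀ v, ψ v = 0 → ψ.rTensor (CoendModule ω) (ρ X v) = 0) :
    ∃ (K : C) (k : K ⟶ X), LinearMap.range (mapLin ω k) = LinearMap.ker ψ := by
  classical
  -- The kernel is finitely generated as `R` is Noetherian, so its generators can be lifted one by
  -- one and collected in a biproduct.
  have key : ∀ S : Finset (ω.obj X), (∀ v ∈ S, ψ v = 0) →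
      ∃ (K : C) (k : K ⟶ X), ψ ∘ₗ mapLin ω k = 0 ∧ ∀ v ∈ S, v ∈ LinearMap.range (mapLin ω k) := by
    intro S hS
    induction S using Finset.induction_on with
    | empty => exact ⟨0, 0, by simp, by simp⟩
    | insert v S _ ih =>
      obtain ⟨K, k, hk, hkS⟩ := ih fun v hv => hS v (Finset.mem_insert_of_mem hv)
      obtain ⟨K', k', u, hu, hk'⟩ := h.exists_lift_of_rTensor_eq_zero hω ψ
        (hψ v (hS v (Finset.mem_insert_self v S)))
      have e : biprod.desc k k' = biprod.fst ≫ k + biprod.snd ≫ k' := by ext <;> simp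
      refine ⟨K ⊞ K', biprod.desc k k', ?_, fun y hy => ?_⟩
      · rw [e, mapLin_add, mapLin_comp, mapLin_comp, LinearMap.comp_add, ← LinearMap.comp_assoc,
          ← LinearMap.comp_assoc, hk, hk', LinearMap.zero_comp, LinearMap.zero_comp, add_zero]
      · obtain rfl | hy := Finset.mem_insert.1 hy
        · exact ⟨mapLin ω biprod.inr u, by rw [← mapLin_comp_apply, biprod.inr_desc, hu]⟩
        · obtain ⟨a, rfl⟩ := hkS y hy
          exact ⟨mapLin ω biprod.inl a, by rw [← mapLin_comp_apply, biprod.inl_desc]⟩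
  obtain ⟨S, hS⟩ := (IsNoetherian.noetherian (LinearMap.ker ψ) : (LinearMap.ker ψ).FG)
  obtain ⟨K, k, hk, hkS⟩ := key S fun v hv => by
    have : v ∈ LinearMap.ker ψ := hS ▸ Submodule.subset_span hv
    exact this
  refine ⟨K, k, le_antisymm (LinearMap.range_le_ker_iff.2 hk) ?_⟩
  rw [← hS]
  exact Submodule.span_le.2 hkS

/-- A linear map compatible with the coactions comes from a morphism. -/
lemma exists_mapLin_eq [ω.Faithful] {X Y : C} (g : ω.obj X →ₗ[R] ω.obj Y)
    (hg : ∀ v, ρ Y (g v) = g.rTensor (CoendModule ω) (ρ X v)) :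
    ∃ f : X ⟶ Y, mapLin ω f = g := by
  -- The kernel of `g ∘ fst - snd` is the graph of `g`. It is the image of `ω(k)`; the projection of
  -- `K` to `X` is epi, and the projection to `Y` descends along it to the required morphism.
  obtain ⟨K, k, hk⟩ := h.exists_range_eq_ker hω
    (g ∘ₗ mapLin ω biprod.fst - mapLin ω (biprod.snd : X ⊞ Y ⟶ Y)) fun v hv => by
      rw [LinearMap.rTensor_sub, LinearMap.sub_apply, h.rTensor_comp_mapLin, ← hg, ← h.natural,
        ← map_sub]
      exact (congrArg _ hv).trans (map_zero _)
  have hg' : mapLin ω (k ≫ biprod.snd) = g ∘ₗ mapLin ω (k ≫ biprod.fst) := by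
    ext t
    have ht : mapLin ω k t ∈ LinearMap.range (mapLin ω k) := ⟨t, rfl⟩
    rw [hk, LinearMap.mem_ker, LinearMap.sub_apply, sub_eq_zero] at ht
    rw [mapLin_comp_apply, LinearMap.comp_apply, mapLin_comp_apply]
    exact ht.symm
  have hsurj : Function.Surjective (mapLin ω (k ≫ biprod.fst)) := fun x => by
    have hx : mapLin ω biprod.inl x + mapLin ω biprod.inr (g x) ∈ LinearMap.range (mapLin ω k) := by
      rw [hk, LinearMap.mem_ker, LinearMap.sub_apply, LinearMap.comp_apply,
        mapLin_fst_inl_add_inr, mapLin_snd_inl_add_inr, sub_self]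
    obtain ⟨t, ht⟩ := hx
    exact ⟨t, by rw [mapLin_comp_apply, ht, mapLin_fst_inl_add_inr]⟩
  have := epi_of_mapLin_surjective _ hsurj
  have hker : kernel.ι (k ≫ biprod.fst) ≫ k ≫ biprod.snd = 0 := by
    apply mapLin_injective (ω := ω)
    rw [mapLin_comp, hg', LinearMap.comp_assoc, ← mapLin_comp, kernel.condition, mapLin_zero,
      mapLin_zero, LinearMap.comp_zero]
  refine ⟨(Abelian.epiDesc (k ≫ biprod.fst) (k ≫ biprod.snd) hker), LinearMap.ext fun x => ?_⟩
  obtain ⟨t, rfl⟩ := hsurj x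
  rw [← mapLin_comp_apply, Abelian.comp_epiDesc, hg', LinearMap.comp_apply]

end IsCanonicalCoaction

end Abelian

end Reconstruction

/-! ### Comparison with comodules and essential surjectivity -/

namespace FinComodule

variable {R : Type w} [CommRing R] {L : Type x} [AddCommGroup L] [Module R L] [Coalgebra R L]

lemma coassoc_apply (E : FinComodule R L) (e : E.toMod) :
    TensorProduct.assoc R _ _ _ (E.coact.rTensor L (E.coact e)) =
      (Coalgebra.comul (R := R) (A := L)).lTensor E.toMod (E.coact e) :=
  LinearMap.congr_fun E.coassoc e

lemma counit_apply (E : FinComodule R L) (e : E.toMod) :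
    TensorProduct.rid R _ ((Coalgebra.counit (R := R) (A := L)).lTensor E.toMod (E.coact e)) = e :=
  LinearMap.congr_fun E.counit e

/-- A bijective homomorphism of comodules is an isomorphism. -/
noncomputable def isoOfBijective {E E' : FinComodule R L} (g : E.toMod →ₗ[R] E'.toMod)
    (hg : E'.coact ∘ₗ g = g.rTensor L ∘ₗ E.coact) (hb : Function.Bijective g) : E ≅ E' where
  hom := ⟨g, hg⟩
  inv := ⟨(LinearEquiv.ofBijective g hb).symm, by
    rw [mem_homSubmodule]
    refine LinearMap.ext fun y => ?_
    obtain ⟨x, rfl⟩ := hb.2 y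
    have e : (LinearEquiv.ofBijective g hb).symm.toLinearMap ∘ₗ g = LinearMap.id :=
      LinearMap.ext (LinearEquiv.ofBijective g hb).symm_apply_apply
    rw [LinearMap.comp_apply, LinearMap.comp_apply, ← LinearMap.comp_apply E'.coact, hg,
      LinearMap.comp_apply, ← LinearMap.rTensor_comp_apply, e, LinearMap.rTensor_id_apply]
    exact congrArg E.coact ((LinearEquiv.ofBijective g hb).symm_apply_apply x)⟩
  hom_inv_id := Subtype.ext (LinearMap.ext (LinearEquiv.ofBijective g hb).symm_apply_apply)
  inv_hom_id := Subtype.ext (LinearMap.ext (LinearEquiv.ofBijective g hb).apply_symm_apply)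

end FinComodule

namespace Reconstruction

open scoped ZeroObject

variable {R : Type w} [CommRing R] {C : Type u} [Category.{v} C] {ω : C ⥤ FGModuleCat.{w} R}
  [Coalgebra R (CoendModule ω)] {ρ : ∀ X : C, ω.obj X →ₗ[R] ω.obj X ⊗[R] CoendModule ω}

/-- The functor from `C` to comodules given by the canonical coactions. -/
def comparison (h : IsCanonicalCoaction ρ) (hρ : IsComoduleStructure ρ) :
    C ⥤ FinComodule R (CoendModule ω) where
  obj X :=
    { toMod := ω.obj X
      coact := ρ X
      coassoc := LinearMap.ext (hρ.coassoc X)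
      counit := LinearMap.ext fun v => by
        rw [LinearMap.comp_apply, LinearMap.comp_apply, hρ.counit]
        simp }
  map f := ⟨mapLin ω f, LinearMap.ext (h.natural f)⟩
  map_id X := Subtype.ext (LinearMap.ext fun v => mapLin_id_apply X v)
  map_comp f g := Subtype.ext (mapLin_comp f g)

/-- The comparison functor lifts `ω`. -/
def comparisonForget (h : IsCanonicalCoaction ρ) (hρ : IsComoduleStructure ρ) :
    comparison h hρ ⋙ FinComodule.forget R (CoendModule ω) ≅ ω :=
  NatIso.ofComponents (fun X => Iso.refl (ω.obj X)) fun f => by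
    refine (Category.comp_id _).trans ((Category.id_comp _).trans ?_).symm
    rfl

lemma coaction_comparisonForget (h : IsCanonicalCoaction ρ) (hρ : IsComoduleStructure ρ) :
    coaction (comparisonForget h hρ) = ρ := by
  funext X
  change LinearMap.rTensor (CoendModule ω) LinearMap.id ∘ₗ ρ X ∘ₗ LinearMap.id = ρ X
  rw [LinearMap.rTensor_id, LinearMap.comp_id, LinearMap.id_comp]

variable [Abelian C] [ω.Additive] [IsNoetherianRing R] [PreservesFiniteLimits ω]
  [PreservesFiniteColimits ω] (h : IsCanonicalCoaction ρ) (hρ : IsComoduleStructure ρ)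
  (hω : HasProjectiveCovers ω) [Module.Flat R (CoendModule ω)]

include h hρ hω

/-- Every element of a comodule lies in the image of a homomorphism from some `ω(X)`. -/
lemma exists_hom_apply_eq (E : FinComodule R (CoendModule ω)) (e : E.toMod) :
    ∃ (X : C) (χ : ω.obj X →ₗ[R] E.toMod) (u : ω.obj X),
      (∀ v, E.coact (χ v) = χ.rTensor _ (ρ X v)) ∧ χ u = e := by
  obtain ⟨X, φ, v, hv⟩ := h.exists_rTensor_eq (E.coact e)
  have hφ : φ v = e := by
    have := E.counit_apply e
    rwa [← hv, ← lTensor_rTensor, hρ.counit, LinearMap.rTensor_tmul, TensorProduct.rid_tmul,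
      one_smul] at this
  -- `φ` need not be a comodule map, but coassociativity on both sides shows that its defect is
  -- killed after tensoring with `L` and applying it to `ρ v`. So the defect vanishes on some `K`
  -- through which `v` lifts.
  have h0 : (E.coact ∘ₗ φ - φ.rTensor _ ∘ₗ ρ X).rTensor (CoendModule ω) (ρ X v) = 0 := by
    rw [LinearMap.rTensor_sub, LinearMap.sub_apply, LinearMap.rTensor_comp_apply,
      LinearMap.rTensor_comp_apply, hv, sub_eq_zero]
    apply (TensorProduct.assoc R _ _ _).injective
    rw [E.coassoc_apply, assoc_rTensor_rTensor, hρ.coassoc, lTensor_rTensor, hv]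
  obtain ⟨K, k, u, rfl, hk⟩ := h.exists_lift_of_rTensor_eq_zero hω _ h0
  refine ⟨K, φ ∘ₗ mapLin ω k, u, fun y => ?_, hφ⟩
  rw [h.rTensor_comp_mapLin]
  exact sub_eq_zero.1 (LinearMap.congr_fun hk y)

/-- Every finite comodule is a quotient of some `ω(X)`. -/
lemma exists_surjective_hom (E : FinComodule R (CoendModule ω)) :
    ∃ (X : C) (χ : ω.obj X →ₗ[R] E.toMod),
      (∀ v, E.coact (χ v) = χ.rTensor _ (ρ X v)) ∧ Function.Surjective χ := by
  classical
  have key : ∀ S : Finset E.toMod, ∃ (X : C) (χ : ω.obj X →ₗ[R] E.toMod),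
      (∀ v, E.coact (χ v) = χ.rTensor _ (ρ X v)) ∧ ∀ e ∈ S, e ∈ LinearMap.range χ := by
    intro S
    induction S using Finset.induction_on with
    | empty => exact ⟨0, 0, by simp, by simp⟩
    | insert e S _ ih =>
      obtain ⟨X, χ, hχ, hS⟩ := ih
      obtain ⟨Y, χ', u, hχ', hu⟩ := exists_hom_apply_eq h hρ hω E e
      refine ⟨X ⊞ Y, χ ∘ₗ mapLin ω biprod.fst + χ' ∘ₗ mapLin ω biprod.snd, fun v => ?_,
        fun y hy => ?_⟩
      · rw [LinearMap.rTensor_add, LinearMap.add_apply _ _ (ρ _ v), h.rTensor_comp_mapLin,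
          h.rTensor_comp_mapLin, ← hχ, ← hχ', ← map_add]
        rfl
      · obtain rfl | hy := Finset.mem_insert.1 hy
        · refine ⟨mapLin ω biprod.inl 0 + mapLin ω biprod.inr u, ?_⟩
          rw [LinearMap.add_apply, LinearMap.comp_apply, LinearMap.comp_apply,
            mapLin_fst_inl_add_inr, mapLin_snd_inl_add_inr, map_zero, zero_add, hu]
        · obtain ⟨a, rfl⟩ := hS y hy
          refine ⟨mapLin ω biprod.inl a + mapLin ω biprod.inr 0, ?_⟩
          rw [LinearMap.add_apply, LinearMap.comp_apply, LinearMap.comp_apply,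
            mapLin_fst_inl_add_inr, mapLin_snd_inl_add_inr, map_zero, add_zero]
  obtain ⟨S, hS⟩ := (Module.Finite.fg_top : (⊤ : Submodule R E.toMod).FG)
  obtain ⟨X, χ, hχ, hSχ⟩ := key S
  refine ⟨X, χ, hχ, LinearMap.range_eq_top.1 (top_le_iff.1 ?_)⟩
  rw [← hS]
  exact Submodule.span_le.2 hSχ

/-- The kernel of a comodule surjection `χ : ω(X) → E` is coaction-stable, hence the image of some
`ω(k)`; by exactness `χ` then induces an isomorphism from `ω(coker k)` to `E`. -/
lemma comparison_essSurj : (comparison h hρ).EssSurj where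
  mem_essImage E := by
    obtain ⟨X, χ, hχ, hsurj⟩ := exists_surjective_hom h hρ hω E
    obtain ⟨K, k, hk⟩ := h.exists_range_eq_ker hω χ fun v hv => by rw [← hχ, hv, map_zero]
    have hπ : Function.Surjective (mapLin ω (cokernel.π k)) := mapLin_surjective_of_epi _
    have hker (v) : mapLin ω (cokernel.π k) v = 0 ↔ χ v = 0 := by
      rw [← LinearMap.mem_ker (f := χ), ← hk]
      refine ⟨fun hv => exists_of_mapLin_eq_zero (cokernel.condition k)
        (ShortComplex.exact_cokernel k) hv, ?_⟩
      rintro ⟨t, rfl⟩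
      rw [← mapLin_comp_apply, cokernel.condition, mapLin_zero, LinearMap.zero_apply]
    obtain ⟨g, hg⟩ := LinearMap.exists_comp_eq_of_ker_le hπ χ fun v => (hker v).1
    have hg' : g ∘ₗ mapLin ω (cokernel.π k) = χ := LinearMap.ext hg
    refine ⟨cokernel k, ⟨FinComodule.isoOfBijective (E := (comparison h hρ).obj (cokernel k)) g
      (LinearMap.ext fun y => ?_) ⟨?_, fun e => ?_⟩⟩⟩
    · obtain ⟨v, rfl⟩ := hπ y
      change E.coact (g _) = g.rTensor _ (ρ _ _)
      rw [hg, hχ, ← h.rTensor_comp_mapLin, hg']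
    · refine (injective_iff_map_eq_zero g).2 fun y hy => ?_
      obtain ⟨v, rfl⟩ := hπ y
      rw [hg] at hy
      exact (hker v).2 hy
    · obtain ⟨v, rfl⟩ := hsurj e
      exact ⟨_, hg v⟩

lemma comparison_isEquivalence [ω.Faithful] : (comparison h hρ).IsEquivalence where
  faithful := ⟨fun hfg => mapLin_injective (ω := ω) (congrArg Subtype.val hfg)⟩
  full := ⟨fun g => by
    obtain ⟨f, hf⟩ := h.exists_mapLin_eq hω (FinComodule.homLinear g)
      (LinearMap.congr_fun ((FinComodule.mem_homSubmodule _).1 g.2))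
    exact ⟨f, Subtype.ext hf⟩⟩
  essSurj := comparison_essSurj h hρ hω

end Reconstruction

open Reconstruction in
theorem mainTheorem1 {R : Type w} [CommRing R] [IsDedekindDomain R]
    {C : Type u} [Category.{v} C] [Abelian C] [Linear R C]
    (ω : C ⥤ FGModuleCat.{w} R) [ω.Additive] [ω.Linear R]
    [PreservesFiniteLimits ω] [PreservesFiniteColimits ω] [ω.Faithful]
    (C₀ : ObjectProperty C) (hC₀ : Reconstruction.IsSubcategoryOfDefinition ω C₀) :
    ∃ _ : Coalgebra R (Reconstruction.CoendModule ω),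
      Module.Flat R (Reconstruction.CoendModule ω) ∧
      (∀ (X : C) (φ : ω.obj X →ₗ[R] R),
        Coalgebra.counit ∘ₗ Reconstruction.coefficient ω X φ = φ) ∧
      ∃ (Φ : C ⥤ FinComodule R (Reconstruction.CoendModule ω))
        (α : Φ ⋙ FinComodule.forget R (Reconstruction.CoendModule ω) ≅ ω),
        Φ.IsEquivalence ∧ Φ.Additive ∧ Φ.Linear R ∧
        (∀ (X : C) (φ : ω.obj X →ₗ[R] R),
          (TensorProduct.lid R (Reconstruction.CoendModule ω)).toLinearMap ∘ₗ
            φ.rTensor (Reconstruction.CoendModule ω) ∘ₗ Reconstruction.coaction α X =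
          Reconstruction.coefficient ω X φ) ∧
        Reconstruction.IsCoend ω (Reconstruction.coaction α) := by
  have hω := hC₀.hasProjectiveCovers
  -- Torsion-free modules over a Dedekind domain are flat; the flatness instances needed below are
  -- inferred from this.
  have : Module.IsTorsionFree R (CoendModule ω) := coendModule_isTorsionFree
  obtain ⟨ρ, h⟩ := exists_canonicalCoaction hω
  obtain ⟨c, hρ, hε⟩ := h.exists_coalgebra hω
  refine ⟨c, inferInstance, fun X φ => LinearMap.ext (hε X φ), comparison h hρ,
    comparisonForget h hρ, comparison_isEquivalence h hρ hω,
    ⟨@fun X Y f g => Subtype.ext (mapLin_add f g)⟩,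
    ⟨@fun X Y f r => Subtype.ext (mapLin_smul r f)⟩, fun X φ => LinearMap.ext fun v => ?_, ?_⟩
  · rw [coaction_comparisonForget]
    exact h.contract φ v
  · rw [coaction_comparisonForget]
    exact ⟨fun X Y f => LinearMap.ext (h.natural f), fun M _ _ t ht => h.existsUnique hω t ht⟩
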